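/- Let $n,d\ge 1$ and let $|\psi\rangle$ be an $n$-qudit generalized $W$-class--vacuum (GWV) state of the qudits $A_1,\dots,A_n$, $$|\psi\rangle=\sqrt p\,\sum_{s=1}^{n}\sum_{i=1}^{d-1}a_{si}\,|0\cdots 0\, i\, 0\cdots 0\rangle+\sqrt{1-p}\,|0\cdots0\rangle,$$ where in the term with coefficient $a_{si}$ the level $i$ is at site $s$, $a_{si}\in\mathbb C$, $\sum_{s,i}|a_{si}|^2=1$ and $0\le p\le 1$. Let $P,P_0,\dots,P_{r-1}$ ($r\ge1$) be non-empty, pairwise disjoint sets of qudits (their union need not contain all $n$ qudits). Write $\rho_{P|P_0\cdots P_{r-1}}$ for the reduced density matrix of $|\psi\rangle$ on $P\cup P_0\cup\dots\cup P_{r-1}$, seen as a bipartite state with parts $P$ and $P_0\cup\dots\cup P_{r-1}$, and $\rho_{PP_j}$ for the reduced density matrix on $P\cup P_j$, seen as a bipartite state with parts $P$ and $P_j$. For a bipartite pure state let $E_\alpha(|\phi\rangle_{AB})=S_\alpha(\mathrm{tr}_B|\phi\rangle\langle\phi|)$, where $S_\alpha(\sigma)=\frac1{1-\alpha}\log_2\mathrm{tr}\,\sigma^\alpha$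 for $\alpha>0$, $\alpha\ne1$, and $S_1(\sigma)=-\mathrm{tr}\,\sigma\log_2\sigma$. The Rényi-$\alpha$ entanglement of assistance of a bipartite mixed state is $$E_\alpha^a(\rho_{AB})=\max\sum_i q_i\,E_\alpha(|\phi_i\rangle_{AB}),$$ the maximum being taken over all finite pure state decompositions $\rho_{AB}=\sum_i q_i|\phi_i\rangle\langle\phi_i|$ with $q_i\ge0$, $\sum_i q_i=1$ and unit vectors $|\phi_i\rangle$. Let $\alpha\in\big[\frac{\sqrt7-1}{2},\frac{\sqrt{13}-1}{2}\big]$, $\mu\in(0,1]$, $0<k\le1$ and $\mathcal K_\mu=\frac{(1+k)^\mu-1}{k^\mu}$. If $$k\,E_\alpha^a(\rho_{PP_l})\ \ge\ \sum_{j=l+1}^{r-1}E_\alpha^a(\rho_{PP_j})\qquad\text{for } l=0,1,\dots,r-2,$$ then $$\big[E_\alpha^a(\rho_{P|P_0\cdots P_{r-1}})\big]^\mu\ \le\ \sum_{j=0}^{r-1}(\mathcal K_\mu)^{j}\,\big[E_\alpha^a(\rho_{PP_j})\big]^\mu .$$ -/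

import Mathlib

noncomputable section

open scoped BigOperators

namespace GWV

/-! ### Bipartite systems

`A` and `B` index orthonormal bases of two finite-dimensional Hilbert spaces. A vector of the
bipartite system is a function `A × B → ℂ` and an operator is a matrix indexed by `A × B`. -/

section Bipartite

variable {A B : Type*} [Fintype B]

/-- The reduced operator `tr_B |φ⟩⟨φ|`. -/
def reducedLeft (φ : A × B → ℂ) : Matrix A A ℂ :=
  Matrix.of fun x x' => ∑ y, φ (x, y) * star (φ (x', y))

theorem reducedLeft_isHermitian (φ : A × B → ℂ) : (reducedLeft φ).IsHermitian := by
  ext x x'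
  simp [reducedLeft, Matrix.conjTranspose_apply, mul_comm]

/-- The Rényi-`α` entropy (in bits) of a Hermitian matrix `ρ` with spectrum `λ`:
`(1 - α)⁻¹ log₂ (tr ρ ^ α)`, where `tr ρ ^ α = ∑ λᵢ ^ α`; for `α = 1` it is the von Neumann entropy
`- tr (ρ log₂ ρ)`. -/
def renyiEntropy [Fintype A] [DecidableEq A] (α : ℝ) (ρ : Matrix A A ℂ) (hρ : ρ.IsHermitian) : ℝ :=
  if α = 1 then -∑ i, hρ.eigenvalues i * Real.logb 2 (hρ.eigenvalues i)
  else 1 / (1 - α) * Real.logb 2 (∑ i, hρ.eigenvalues i ^ α)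

/-- The Rényi-`α` entanglement of the bipartite pure state `φ`. -/
def pureRenyiEntanglement [Fintype A] [DecidableEq A] (α : ℝ) (φ : A × B → ℂ) : ℝ :=
  renyiEntropy α (reducedLeft φ) (reducedLeft_isHermitian φ)

/-- `{q i, φ i}` is a pure state decomposition of `ρ`: the `q i` are probabilities, the `φ i` are
unit vectors, and `ρ = ∑ i, q i |φ i⟩⟨φ i|`. -/
structure IsPureDecomposition [Fintype A] (ρ : Matrix (A × B) (A × B) ℂ) {N : ℕ}
    (q : Fin N → ℝ) (φ : Fin N → A × B → ℂ) : Prop where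
  nonneg : ∀ i, 0 ≤ q i
  sum_eq_one : ∑ i, q i = 1
  unit : ∀ i, ∑ x, ‖φ i x‖ ^ 2 = 1
  decomp : ρ = ∑ i, (q i : ℂ) • Matrix.vecMulVec (φ i) (star (φ i))

/-- The Rényi-`α` entanglement of assistance: the maximum, over all pure state decompositions of
`ρ`, of the average Rényi-`α` entanglement. -/
def renyiAssistance [Fintype A] [DecidableEq A] (α : ℝ) (ρ : Matrix (A × B) (A × B) ℂ) : ℝ :=
  sSup {e : ℝ | ∃ (N : ℕ) (q : Fin N → ℝ) (φ : Fin N → A × B → ℂ),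
    IsPureDecomposition ρ q φ ∧ e = ∑ i, q i * pureRenyiEntanglement α (φ i)}

end Bipartite

/-! ### Systems of `n` qudits with `d` levels `0, …, d - 1`

The product basis of the system is indexed by `Fin n → Fin d`. -/

section Multipartite

variable {n d : ℕ}

/-- The generalized `W`-class vector `∑ s, ∑ i ≠ 0, a s i |0 … 0 i 0 … 0⟩`, with `i` at site `s`. -/
def wState [NeZero d] (a : Fin n → Fin d → ℂ) : (Fin n → Fin d) → ℂ :=
  ∑ s : Fin n, ∑ i ∈ Finset.univ.erase (0 : Fin d),
    a s i • (Pi.single (Pi.single s i : Fin n → Fin d) 1 : (Fin n → Fin d) → ℂ)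

/-- The superposition `√p |W⟩ + √(1 - p) |0 … 0⟩`. -/
def gwvState [NeZero d] (p : ℝ) (a : Fin n → Fin d → ℂ) : (Fin n → Fin d) → ℂ :=
  (Real.sqrt p : ℂ) • wState a +
    (Real.sqrt (1 - p) : ℂ) • (Pi.single (0 : Fin n → Fin d) 1 : (Fin n → Fin d) → ℂ)

/-- The basis label of the whole system given by labels of the (disjoint) blocks `P` and `Q` and of
the remaining sites. -/
def glue (P Q : Finset (Fin n)) (x : ↥P → Fin d) (y : ↥Q → Fin d)
    (z : ↥((P ∪ Q)ᶜ) → Fin d) : Fin n → Fin d := fun s =>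
  if hP : s ∈ P then x ⟨s, hP⟩
  else if hQ : s ∈ Q then y ⟨s, hQ⟩
  else z ⟨s, by simp [hP, hQ]⟩

/-- The reduced density matrix of the pure state `ψ` on the (disjoint) blocks `P` and `Q`, as an
operator of the bipartite system `P | Q`: all the other sites are traced out. -/
def reducedState (ψ : (Fin n → Fin d) → ℂ) (P Q : Finset (Fin n)) :
    Matrix ((↥P → Fin d) × (↥Q → Fin d)) ((↥P → Fin d) × (↥Q → Fin d)) ℂ :=
  Matrix.of fun u v =>
    ∑ z : ↥((P ∪ Q)ᶜ) → Fin d, ψ (glue P Q u.1 u.2 z) * star (ψ (glue P Q v.1 v.2 z))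

end Multipartite

end GWV

end

noncomputable section

open scoped BigOperators

namespace GWV

open Real Set

/-! ### The Taylor coefficients of a combination of hyperbolic sines -/

/-! Tracing out the sites outside `P ∪ Q` leaves a state supported on the span of the vacuum o and w
= w_P ⊗ |0⟩ + |0⟩ ⊗ w_Q (`reducedState_gwvState`). So every member of nonzero weight in a
decomposition is x w + y o. Its reduced operator has rank at most two, and its entropy is f(s) =
`binaryRenyi α s` with s = 4|x|⁴‖w_P‖²‖w_Q‖², whatever y is (`pureRenyiEntanglement_superposition`).

Since s is linear in ‖w_Q‖², it is additive over disjoint blocks Q_j. As f is concave on [0, 1] with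
f(0) = 0, it is subadditive, so each term of an average for the large state is at most the sum of
the corresponding terms for the pairs P, Q_j. The latter come from genuine decompositions of the
smaller states: the same x_i serve once the y_i are adjusted to restore normalization
(`average_le_renyiAssistance_vacuumMixture`). This is polygamy for μ = 1
(`renyiAssistance_gwvState_biUnion_le`); passing to general μ is an inequality between nonnegative
reals (`sum_rpow_le`).

The range of α enters only through nonnegativity and concavity of f. For α ≠ 1, putting √(1 - s) =
tanh y makes f' a positive multiple of `renyiSlope`, whose monotonicity in y becomes a sinh
inequality verified on Taylor coefficients. The cubic coefficient forces α² + α ≤ 3. The case α = 1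
follows by a limit. -/

theorem three_mul_two_pow_le (m : ℕ) : 3 * (2 : ℝ) ^ (2 * m + 5) - 4 ≤ (3 ^ (2 * m + 5) + 1) / 2 := by
  induction m with
  | zero => norm_num
  | succ m ih =>
    have e2 : (2 : ℝ) ^ (2 * (m + 1) + 5) = 4 * 2 ^ (2 * m + 5) := by ring
    have e3 : (3 : ℝ) ^ (2 * (m + 1) + 5) = 9 * 3 ^ (2 * m + 5) := by ring
    have : (3 : ℝ) ^ (2 * m + 5) = 243 * 3 ^ (2 * m) := by ring
    have : (1 : ℝ) ≤ 3 ^ (2 * m) := one_le_pow₀ (by norm_num)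
    rw [e2, e3]
    linarith

/-- With δ = 2(α - 1), these govern the Taylor series of the numerator of the derivative of
`renyiSlope`; the outer δ carries the sign of α - 1. The expression vanishes for m = 0 and equals
2δ²(4 - 6δ - δ²) for m = 1, which is where the hypothesis `h1` comes from. -/
theorem mul_sinh_coeff_nonneg {δ : ℝ} (h0 : -1 ≤ δ) (h1 : δ ^ 2 + 6 * δ ≤ 4) (m : ℕ) :
    0 ≤ δ * (δ / 2 * (3 ^ (2 * m + 1) + 1) + 4 - 3 * (1 + δ) ^ (2 * m + 1)
      - (1 - δ) ^ (2 * m + 1)) := by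
  have h2 : δ ≤ 1 := by nlinarith
  rcases le_total 0 δ with hδ | hδ
  · refine mul_nonneg hδ ?_
    match m with
    | 0 => norm_num; linarith
    | 1 => norm_num; nlinarith [mul_nonneg hδ (sub_nonneg.2 h1)]
    | m + 2 =>
      have e : 2 * (m + 2) + 1 = 2 * m + 5 := by ring
      rw [e]
      -- The chord of the convex power over [1, 2]. What remains is δ times a numerical inequality
      -- that holds from exponent 5 on but fails at 3.
      have c1 : (1 + δ) ^ (2 * m + 5) ≤ (1 - δ) + δ * 2 ^ (2 * m + 5) := by
        have := (convexOn_pow (𝕜 := ℝ) (2 * m + 5)).2 (x := 1) (y := 2) (by simp) (by simp)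
          (sub_nonneg.2 h2) hδ (by ring)
        simp only [smul_eq_mul, one_pow, mul_one] at this
        rwa [show 1 - δ + δ * 2 = 1 + δ by ring] at this
      have c2 : (1 - δ) ^ (2 * m + 5) ≤ 1 - δ :=
        pow_le_of_le_one (by linarith) (by linarith) (by positivity)
      have := mul_le_mul_of_nonneg_left (three_mul_two_pow_le m) hδ
      nlinarith
  · refine mul_nonneg_of_nonpos_of_nonpos hδ ?_
    -- With K = 2m + 1, Bernoulli on both powers bounds the bracket above by δ(3^K + 1 - 4K)/2.
    have b1 := one_add_mul_le_pow (a := δ) (by linarith) (2 * m + 1)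
    have b2 := one_add_mul_le_pow (a := -δ) (by linarith) (2 * m + 1)
    have b3 : 4 * ((2 * m + 1 : ℕ) : ℝ) ≤ 3 ^ (2 * m + 1) + 1 := by
      have := one_add_mul_le_pow (a := (8 : ℝ)) (by norm_num) m
      rw [pow_succ, pow_mul]
      norm_num at this ⊢
      linarith
    have b4 := mul_le_mul_of_nonpos_left b3 hδ
    rw [← sub_eq_add_neg] at b2
    nlinarith

theorem mul_sinh_combination_nonneg {δ y : ℝ} (h0 : -1 ≤ δ) (h1 : δ ^ 2 + 6 * δ ≤ 4)
    (hy : 0 ≤ y) :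
    0 ≤ δ * (δ / 2 * sinh (3 * y) + (4 + δ / 2) * sinh y - 3 * sinh ((1 + δ) * y)
      - sinh ((1 - δ) * y)) := by
  have H := (((((hasSum_sinh (3 * y)).mul_left (δ / 2)).add
    ((hasSum_sinh y).mul_left (4 + δ / 2))).sub
    ((hasSum_sinh ((1 + δ) * y)).mul_left 3)).sub (hasSum_sinh ((1 - δ) * y))).mul_left δ
  refine H.nonneg fun m => ?_
  have := mul_nonneg (mul_sinh_coeff_nonneg h0 h1 m)
    (by positivity : 0 ≤ y ^ (2 * m + 1) / ((2 * m + 1).factorial : ℝ))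
  convert this using 1
  simp only [mul_pow]
  ring

/-- Up to a constant, the derivative of the binary Rényi entropy with respect to the squared
concurrence `1 - tanh y ^ 2`. -/
def renyiSlope (α y : ℝ) : ℝ :=
  sinh ((α - 1) * y) * cosh y ^ 2 / ((α - 1) * (sinh y * cosh (α * y)))

/-- Product-to-sum formulas linearize the numerator of the derivative of `renyiSlope`, so that its
Taylor series can be read off. -/
theorem sinh_combination_eq (α y : ℝ) :
    4 * ((α - 1) * cosh ((α - 1) * y) * cosh y * sinh y * cosh (α * y)
      + 2 * sinh ((α - 1) * y) * sinh y ^ 2 * cosh (α * y)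
      - sinh ((α - 1) * y) * cosh y ^ 2 * cosh (α * y)
      - α * sinh ((α - 1) * y) * cosh y * sinh y * sinh (α * y)) =
    2 * (α - 1) / 2 * sinh (3 * y) + (4 + 2 * (α - 1) / 2) * sinh y
      - 3 * sinh ((1 + 2 * (α - 1)) * y) - sinh ((1 - 2 * (α - 1)) * y) := by
  have e1 : α * y = (α - 1) * y + y := by ring
  have e2 : (1 + 2 * (α - 1)) * y = (α - 1) * y + (α - 1) * y + y := by ring
  have e3 : (1 - 2 * (α - 1)) * y = y - ((α - 1) * y + (α - 1) * y) := by ring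
  have e4 : 3 * y = y + y + y := by ring
  rw [e2, e3, e4, e1]
  generalize (α - 1) * y = b
  simp only [sinh_add, cosh_add, sinh_sub]
  have p1 := cosh_sq y
  have p2 := cosh_sq b
  generalize cosh y = C at *
  generalize sinh y = S at *
  generalize cosh b = c at *
  generalize sinh b = s at *
  have p1' : C ^ 3 = C * (S ^ 2 + 1) := by rw [← p1]; ring
  ring_nf
  grind

theorem monotoneOn_renyiSlope {α : ℝ} (h0 : 1 / 2 ≤ α) (h1 : α ^ 2 + α ≤ 3) (hα : α ≠ 1) :
    MonotoneOn (renyiSlope α) (Ioi 0) := by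
  have hβ : α - 1 ≠ 0 := sub_ne_zero.2 hα
  have hd : ∀ y ∈ Ioi (0 : ℝ), HasDerivAt (renyiSlope α)
      (((α - 1) * (sinh y * cosh (α * y)))⁻¹ ^ 2 * (cosh y * ((α - 1) *
        ((α - 1) * cosh ((α - 1) * y) * cosh y * sinh y * cosh (α * y)
      + 2 * sinh ((α - 1) * y) * sinh y ^ 2 * cosh (α * y)
      - sinh ((α - 1) * y) * cosh y ^ 2 * cosh (α * y)
      - α * sinh ((α - 1) * y) * cosh y * sinh y * sinh (α * y))))) y := by
    intro y hy
    have hs : sinh y ≠ 0 := (sinh_pos_iff.2 hy).ne'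
    have hc : cosh (α * y) ≠ 0 := (cosh_pos _).ne'
    have d1 : HasDerivAt (fun y => sinh ((α - 1) * y)) (cosh ((α - 1) * y) * (α - 1)) y := by
      simpa using ((hasDerivAt_id y).const_mul (α - 1)).sinh
    have d2 : HasDerivAt (fun y => cosh (α * y)) (sinh (α * y) * α) y := by
      simpa using ((hasDerivAt_id y).const_mul α).cosh
    have := (d1.mul ((hasDerivAt_cosh y).pow 2)).div (((hasDerivAt_sinh y).mul d2).const_mul (α - 1))
      (mul_ne_zero hβ (mul_ne_zero hs hc))
    refine this.congr_deriv ?_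
    simp only [Pi.pow_apply, Pi.mul_apply]
    field_simp
    ring
  refine monotoneOn_of_deriv_nonneg (convex_Ioi 0)
    (fun y hy => (hd y hy).continuousAt.continuousWithinAt)
    (fun y hy => (hd y (by simpa using hy)).differentiableAt.differentiableWithinAt) ?_
  intro y hy
  rw [interior_Ioi] at hy
  rw [(hd y hy).deriv]
  refine mul_nonneg (sq_nonneg _) (mul_nonneg (cosh_pos _).le ?_)
  have := mul_sinh_combination_nonneg (δ := 2 * (α - 1)) (y := y) (by linarith) (by nlinarith)
    (le_of_lt hy)
  rw [← sinh_combination_eq] at this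
  linarith

/-! ### The Rényi entropy of a two-level system -/

/-- The Rényi-`α` entropy of the spectrum `{(1 + √(1 - s)) / 2, (1 - √(1 - s)) / 2}`, that is, the
Rényi-`α` entanglement of a two-qubit pure state with squared concurrence `s`. -/
def binaryRenyi (α s : ℝ) : ℝ :=
  if α = 1 then -((1 + √(1 - s)) / 2 * logb 2 ((1 + √(1 - s)) / 2)
    + (1 - √(1 - s)) / 2 * logb 2 ((1 - √(1 - s)) / 2))
  else 1 / (1 - α) * logb 2 (((1 + √(1 - s)) / 2) ^ α + ((1 - √(1 - s)) / 2) ^ α)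

theorem binaryRenyi_zero {α : ℝ} (h0 : 0 < α) : binaryRenyi α 0 = 0 := by
  simp [binaryRenyi, Real.zero_rpow h0.ne']

theorem sqrt_one_sub_mem {s : ℝ} (hs : 0 ≤ s) : √(1 - s) ∈ Icc (0 : ℝ) 1 :=
  ⟨sqrt_nonneg _, sqrt_le_one.2 (by linarith)⟩

theorem continuousOn_binaryRenyi {α : ℝ} (h0 : 0 < α) : ContinuousOn (binaryRenyi α) (Icc 0 1) := by
  by_cases hα : α = 1
  · have : binaryRenyi α = fun s => (negMulLog ((1 + √(1 - s)) / 2)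
        + negMulLog ((1 - √(1 - s)) / 2)) / log 2 := by
      funext s
      simp only [binaryRenyi, if_pos hα, negMulLog, logb]
      ring
    rw [this]
    fun_prop
  · have : binaryRenyi α = fun s => 1 / (1 - α) *
        (log (((1 + √(1 - s)) / 2) ^ α + ((1 - √(1 - s)) / 2) ^ α) / log 2) := by
      funext s
      simp only [binaryRenyi, if_neg hα, logb]
    rw [this]
    have c : ∀ f : ℝ → ℝ, Continuous f → Continuous fun s => f s ^ α := fun f hf =>
      hf.rpow_const fun _ => Or.inr h0.le
    have c1 := c (fun s => (1 + √(1 - s)) / 2) (by fun_prop)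
    have c2 := c (fun s => (1 - √(1 - s)) / 2) (by fun_prop)
    refine continuousOn_const.mul (ContinuousOn.div_const (ContinuousOn.log
      (c1.add c2).continuousOn fun s hs => ?_) _)
    have ht := sqrt_one_sub_mem hs.1
    exact (add_pos_of_pos_of_nonneg (rpow_pos_of_pos (by linarith [ht.1]) _)
      (rpow_nonneg (by linarith [ht.2]) _)).ne'

theorem one_add_tanh_div_two (y : ℝ) : (1 + tanh y) / 2 = exp y / (2 * cosh y) := by
  rw [tanh_eq_sinh_div_cosh, ← cosh_add_sinh]
  have := (cosh_pos y).ne'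
  field_simp

theorem one_sub_tanh_div_two (y : ℝ) : (1 - tanh y) / 2 = exp (-y) / (2 * cosh y) := by
  rw [tanh_eq_sinh_div_cosh, ← cosh_sub_sinh]
  have := (cosh_pos y).ne'
  field_simp

/-- With tanh y = √(1 - s) the two eigenvalues are exp(±y) / (2 cosh y), so their powers are again
exponentials and the derivative becomes hyperbolic. -/
theorem hasDerivAt_binaryRenyi {α s : ℝ} (hα : α ≠ 1) (hs : s ∈ Ioo (0 : ℝ) 1) :
    HasDerivAt (binaryRenyi α) (α / (2 * log 2) * renyiSlope α (artanh √(1 - s))) s := by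
  have ht : √(1 - s) ∈ Ioo (0 : ℝ) 1 :=
    ⟨sqrt_pos.2 (by linarith [hs.2]), by rw [sqrt_lt' one_pos]; linarith [hs.1]⟩
  have hy : 0 < artanh √(1 - s) := artanh_pos ht
  have hty : tanh (artanh √(1 - s)) = √(1 - s) := tanh_artanh ⟨by linarith [ht.1], ht.2⟩
  have d0 : HasDerivAt (fun s => √(1 - s)) (-1 / (2 * √(1 - s))) s := by
    simpa using ((hasDerivAt_id s).const_sub 1).sqrt (by simp; linarith [hs.2])
  have p1 : 0 < (1 + √(1 - s)) / 2 := by linarith [ht.1]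
  have p2 : 0 < (1 - √(1 - s)) / 2 := by linarith [ht.2]
  have d1 := ((d0.const_add 1).div_const 2).rpow_const (p := α) (Or.inl p1.ne')
  have d2 := ((d0.const_sub 1).div_const 2).rpow_const (p := α) (Or.inl p2.ne')
  have hpos : 0 < ((1 + √(1 - s)) / 2) ^ α + ((1 - √(1 - s)) / 2) ^ α := by positivity
  have d3 := (((d1.add d2).log hpos.ne').div_const (log 2)).const_mul (1 / (1 - α))
  have e : binaryRenyi α = fun s => 1 / (1 - α) *
        (log (((1 + √(1 - s)) / 2) ^ α + ((1 - √(1 - s)) / 2) ^ α) / log 2) := by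
      funext s
      simp only [binaryRenyi, if_neg hα, logb]
  rw [e]
  refine d3.congr_deriv ?_
  generalize artanh √(1 - s) = y at *
  simp only [Pi.add_apply]
  rw [← hty] at *
  have hc := cosh_pos y
  have hsn : 0 < sinh y := sinh_pos_iff.2 hy
  have hca := cosh_pos (α * y)
  have hβ : α - 1 ≠ 0 := sub_ne_zero.2 hα
  have hβ' : 1 - α ≠ 0 := sub_ne_zero.2 (Ne.symm hα)
  have hl : log 2 ≠ 0 := (log_pos (by norm_num)).ne'
  have r : ∀ b z : ℝ, (exp z / (2 * cosh y)) ^ b = exp (b * z) / (2 * cosh y) ^ b := fun b z => by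
    rw [div_rpow (exp_pos _).le (by positivity), ← exp_mul, mul_comm]
  rw [one_add_tanh_div_two, one_sub_tanh_div_two, r, r, r, r, rpow_sub_one (by positivity)]
  have hq : 0 < (2 * cosh y) ^ α := by positivity
  rw [renyiSlope, sinh_eq ((α - 1) * y)]
  have hca' : exp (α * y) + exp (α * -y) = 2 * cosh (α * y) := by rw [cosh_eq]; ring_nf
  have : exp (-((α - 1) * y)) = exp ((α - 1) * -y) := by ring_nf
  rw [← add_div, hca', this, tanh_eq_sinh_div_cosh]
  generalize exp ((α - 1) * y) = u
  generalize exp ((α - 1) * -y) = v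
  field_simp
  ring

theorem concaveOn_binaryRenyi_of_ne_one {α : ℝ} (h0 : 1 / 2 ≤ α) (h1 : α ^ 2 + α ≤ 3) (hα : α ≠ 1) :
    ConcaveOn ℝ (Icc 0 1) (binaryRenyi α) := by
  refine AntitoneOn.concaveOn_of_deriv (convex_Icc 0 1) (continuousOn_binaryRenyi (by linarith))
    ?_ ?_ <;> rw [interior_Icc]
  · exact fun s hs => (hasDerivAt_binaryRenyi hα hs).differentiableAt.differentiableWithinAt
  · intro s hs t ht hst
    rw [(hasDerivAt_binaryRenyi hα hs).deriv, (hasDerivAt_binaryRenyi hα ht).deriv]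
    have hm : ∀ s ∈ Ioo (0 : ℝ) 1, √(1 - s) ∈ Ioo (0 : ℝ) 1 := fun s hs =>
      ⟨sqrt_pos.2 (by linarith [hs.2]), by rw [sqrt_lt' one_pos]; linarith [hs.1]⟩
    refine mul_le_mul_of_nonneg_left (monotoneOn_renyiSlope h0 h1 hα (artanh_pos (hm t ht))
      (artanh_pos (hm s hs)) (artanh_le_artanh (by linarith [(hm t ht).1]) (hm s hs).2
        (sqrt_le_sqrt (by linarith)))) ?_
    have := log_pos (by norm_num : (1 : ℝ) < 2)
    positivity

open Filter Topology in
-- For eigenvalues u, v the entropy is minus the difference quotient at α = 1 of log₂(u^α + v^α),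
-- which vanishes there; the limit is minus its derivative.
theorem tendsto_binaryRenyi {s : ℝ} (hs : s ∈ Icc (0 : ℝ) 1) :
    Tendsto (fun α => binaryRenyi α s) (𝓝[≠] 1) (𝓝 (binaryRenyi 1 s)) := by
  -- At s = 0 an eigenvalue vanishes, and differentiating its power in the exponent needs a positive
  -- base.
  rcases hs.1.eq_or_lt with rfl | h0
  · rw [binaryRenyi_zero one_pos]
    refine tendsto_const_nhds.congr' ?_
    filter_upwards [nhdsWithin_le_nhds (lt_mem_nhds (one_pos (α := ℝ)))] with α hα
    rw [binaryRenyi_zero hα]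
  have ht := sqrt_one_sub_mem hs.1
  have ht1 : √(1 - s) < 1 := by rw [sqrt_lt' one_pos]; linarith
  have p1 : 0 < (1 + √(1 - s)) / 2 := by linarith [ht.1]
  have p2 : 0 < (1 - √(1 - s)) / 2 := by linarith
  have hsum : (1 + √(1 - s)) / 2 + (1 - √(1 - s)) / 2 = 1 := by ring
  simp only [binaryRenyi]
  generalize (1 + √(1 - s)) / 2 = u at *
  generalize (1 - √(1 - s)) / 2 = v at *
  have d := ((((hasDerivAt_id (1 : ℝ)).const_rpow p1).add
    ((hasDerivAt_id (1 : ℝ)).const_rpow p2)).log (by simp [hsum])).div_const (log 2)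
  have := d.tendsto_slope.neg
  refine (this.congr' ?_).trans_eq ?_
  · filter_upwards [self_mem_nhdsWithin] with α hα
    have : 1 - α ≠ 0 := sub_ne_zero.2 (Ne.symm hα)
    have : α - 1 ≠ 0 := sub_ne_zero.2 hα
    rw [if_neg (by simpa using hα)]
    simp only [slope_def_field, Pi.add_apply, id, rpow_one, hsum, log_one, logb]
    field_simp
    ring
  · simp [hsum, logb]
    ring_nf

theorem concaveOn_binaryRenyi {α : ℝ} (h0 : 1 / 2 < α) (h1 : α ^ 2 + α ≤ 3) :
    ConcaveOn ℝ (Icc 0 1) (binaryRenyi α) := by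
  by_cases hα : α = 1
  · subst hα
    refine ⟨convex_Icc 0 1, fun x hx y hy a b ha hb hab => ?_⟩
    have hz := (convex_Icc (0 : ℝ) 1) hx hy ha hb hab
    refine le_of_tendsto_of_tendsto (((tendsto_binaryRenyi hx).const_smul a).add
      ((tendsto_binaryRenyi hy).const_smul b)) (tendsto_binaryRenyi hz) ?_
    have hI : Ioo (1 / 2 : ℝ) (5 / 4) ∈ nhds 1 := Ioo_mem_nhds (by norm_num) (by norm_num)
    filter_upwards [self_mem_nhdsWithin, nhdsWithin_le_nhds hI] with α hα hI
    exact (concaveOn_binaryRenyi_of_ne_one hI.1.le (by nlinarith [hI.1, hI.2]) hα).2 hx hy ha hb hab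
  · exact concaveOn_binaryRenyi_of_ne_one h0.le h1 hα

theorem binaryRenyi_one (α : ℝ) : binaryRenyi α 1 = 1 := by
  have hl : log 2 ≠ 0 := (log_pos (by norm_num)).ne'
  by_cases hα : α = 1
  · simp only [binaryRenyi, if_pos hα]
    simp [logb, hl]
    field_simp
    norm_num
  · have : 1 - α ≠ 0 := sub_ne_zero.2 (Ne.symm hα)
    simp only [binaryRenyi, if_neg hα, logb]
    rw [sub_self, sqrt_zero, add_zero, sub_zero, ← two_mul, log_mul (by norm_num) (by positivity),
      log_rpow (by norm_num), one_div 2, log_inv]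
    field_simp
    ring

/-- By concavity the graph lies above the chord from (0, 0) to (1, 1). -/
theorem binaryRenyi_nonneg {α s : ℝ} (h0 : 1 / 2 < α) (h1 : α ^ 2 + α ≤ 3)
    (hs : s ∈ Icc (0 : ℝ) 1) : 0 ≤ binaryRenyi α s := by
  have := (concaveOn_binaryRenyi h0 h1).2 (show (0 : ℝ) ∈ Icc 0 1 by simp)
    (show (1 : ℝ) ∈ Icc 0 1 by simp) (sub_nonneg.2 hs.2) hs.1 (by ring)
  rw [binaryRenyi_zero (by linarith), binaryRenyi_one] at this
  simp at this
  linarith [hs.1]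

theorem binaryRenyi_add_le {α s t : ℝ} (h0 : 1 / 2 < α) (h1 : α ^ 2 + α ≤ 3) (hs : 0 ≤ s)
    (ht : 0 ≤ t) (hst : s + t ≤ 1) :
    binaryRenyi α (s + t) ≤ binaryRenyi α s + binaryRenyi α t := by
  rcases (add_nonneg hs ht).eq_or_lt with h | h
  · obtain rfl : s = 0 := by linarith
    simp [binaryRenyi_zero (by linarith : 0 < α)]
  have key : ∀ u v : ℝ, 0 ≤ u → 0 ≤ v → u + v = s + t →
      u / (s + t) * binaryRenyi α (s + t) ≤ binaryRenyi α u := fun u v hu hv huv => by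
    have := (concaveOn_binaryRenyi h0 h1).2 (show s + t ∈ Icc 0 1 from ⟨h.le, hst⟩)
      (show (0 : ℝ) ∈ Icc 0 1 by simp) (show 0 ≤ u / (s + t) by positivity)
      (show 0 ≤ v / (s + t) by positivity)
      (by rw [← add_div, huv, div_self h.ne'])
    rw [binaryRenyi_zero (by linarith)] at this
    simpa [div_mul_cancel₀ _ h.ne'] using this
  have e : s / (s + t) + t / (s + t) = 1 := by rw [← add_div, div_self h.ne']
  calc binaryRenyi α (s + t)
      = s / (s + t) * binaryRenyi α (s + t) + t / (s + t) * binaryRenyi α (s + t) := by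
        rw [← add_mul, e, one_mul]
    _ ≤ _ := add_le_add (key s t hs ht rfl) (key t s ht hs (add_comm _ _))

theorem binaryRenyi_sum_le {α : ℝ} (h0 : 1 / 2 < α) (h1 : α ^ 2 + α ≤ 3) {ι : Type*}
    (S : Finset ι) (s : ι → ℝ) (hs : ∀ i ∈ S, 0 ≤ s i) (hS : ∑ i ∈ S, s i ≤ 1) :
    binaryRenyi α (∑ i ∈ S, s i) ≤ ∑ i ∈ S, binaryRenyi α (s i) := by
  classical
  induction S using Finset.induction_on with
  | empty => simp [binaryRenyi_zero (by linarith : 0 < α)]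
  | insert i S hi ih =>
    rw [Finset.sum_insert hi] at hS ⊢
    rw [Finset.sum_insert hi]
    have hn : 0 ≤ ∑ j ∈ S, s j := Finset.sum_nonneg fun j hj => hs j (Finset.mem_insert_of_mem hj)
    have hi0 := hs i (Finset.mem_insert_self _ _)
    exact (binaryRenyi_add_le h0 h1 hi0 hn hS).trans (add_le_add_right
      (ih (fun j hj => hs j (Finset.mem_insert_of_mem hj)) (by linarith)) _)

theorem exists_binaryRenyi_le {α : ℝ} (h0 : 0 < α) :
    ∃ M, ∀ s ∈ Icc (0 : ℝ) 1, binaryRenyi α s ≤ M := by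
  obtain ⟨M, hM⟩ := isCompact_Icc.bddAbove_image (continuousOn_binaryRenyi h0)
  exact ⟨M, fun s hs => hM (mem_image_of_mem _ hs)⟩

/-! ### The power inequality -/

/-- Divided by t^μ, this says that (1 + u)^μ - u^μ does not increase from v = 1/k to u = 1/t. The
points v + 1 and u are convex combinations of v and u + 1 with swapped weights, so two uses of
concavity add up to the claim. -/
theorem one_add_rpow_le {μ k t : ℝ} (hμ : μ ∈ Ioc (0 : ℝ) 1) (hk : 0 < k) (ht : 0 ≤ t)
    (htk : t ≤ k) : (1 + t) ^ μ ≤ 1 + ((1 + k) ^ μ - 1) / k ^ μ * t ^ μ := by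
  rcases ht.eq_or_lt with rfl | ht
  · simp [Real.zero_rpow hμ.1.ne']
  have hc := Real.concaveOn_rpow hμ.1.le hμ.2
  have hv : 0 < 1 / k := by positivity
  have hvu : 1 / k ≤ 1 / t := one_div_le_one_div_of_le ht htk
  have key : (1 / t + 1) ^ μ + (1 / k) ^ μ ≤ (1 / k + 1) ^ μ + (1 / t) ^ μ := by
    generalize 1 / t = u at *
    generalize 1 / k = v at *
    have hw : 0 < u + 1 - v := by linarith
    have hv' : v ∈ Ici 0 := hv.le
    have hu' : u + 1 ∈ Ici 0 := by rw [mem_Ici]; linarith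
    have w1 : 0 ≤ (u - v) / (u + 1 - v) := div_nonneg (by linarith) hw.le
    have w2 : 0 ≤ 1 / (u + 1 - v) := by positivity
    have a1 := hc.2 hv' hu' w1 w2 (by field_simp; ring)
    have a2 := hc.2 hv' hu' w2 w1 (by field_simp; ring)
    simp only [smul_eq_mul] at a1 a2
    have x1 : (u - v) / (u + 1 - v) * v + 1 / (u + 1 - v) * (u + 1) = v + 1 := by
      field_simp; ring
    have x2 : 1 / (u + 1 - v) * v + (u - v) / (u + 1 - v) * (u + 1) = u := by
      field_simp; ring
    have x3 : (u - v) / (u + 1 - v) = 1 - 1 / (u + 1 - v) := by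
      field_simp; ring
    rw [x1] at a1
    rw [x2] at a2
    rw [x3] at a1 a2
    linarith
  have e : ∀ x : ℝ, 0 < x → (1 / x + 1) ^ μ = (1 + x) ^ μ / x ^ μ ∧ (1 / x) ^ μ = 1 / x ^ μ :=
    fun x hx => ⟨by rw [← div_rpow (by linarith) hx.le]; congr 1; field_simp,
      by rw [div_rpow one_pos.le hx.le, one_rpow]⟩
  rw [(e t ht).1, (e t ht).2, (e k hk).1, (e k hk).2] at key
  have htp : 0 < t ^ μ := rpow_pos_of_pos ht _
  have := mul_le_mul_of_nonneg_right key htp.le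
  rw [add_mul, add_mul, div_mul_cancel₀ _ htp.ne', div_mul_cancel₀ _ htp.ne'] at this
  rw [sub_div]
  linarith

theorem add_rpow_le {μ k x y : ℝ} (hμ : μ ∈ Ioc (0 : ℝ) 1) (hk : 0 < k) (hx : 0 ≤ x) (hy : 0 ≤ y)
    (hyx : y ≤ k * x) : (x + y) ^ μ ≤ x ^ μ + ((1 + k) ^ μ - 1) / k ^ μ * y ^ μ := by
  rcases hx.eq_or_lt with rfl | hx
  · obtain rfl : y = 0 := by linarith
    simp [Real.zero_rpow hμ.1.ne']
  have := mul_le_mul_of_nonneg_left (one_add_rpow_le hμ hk (t := y / x) (by positivity)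
    (by rwa [div_le_iff₀ hx])) (rpow_nonneg hx.le μ)
  rw [← mul_rpow hx.le (by positivity), mul_add, mul_add, mul_div_cancel₀ _ hx.ne', mul_one,
    div_rpow hy hx.le] at this
  refine this.trans_eq ?_
  have := (rpow_pos_of_pos hx μ).ne'
  rw [mul_left_comm, mul_div_cancel₀ _ this, mul_one]

theorem sum_rpow_le {μ k : ℝ} (hμ : μ ∈ Ioc (0 : ℝ) 1) (hk : 0 < k) {r : ℕ} (E : Fin r → ℝ)
    (hE : ∀ j, 0 ≤ E j)
    (hcond : ∀ l : Fin r, (l : ℕ) + 1 < r → ∑ j ∈ Finset.Ioi l, E j ≤ k * E l) :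
    (∑ j, E j) ^ μ ≤ ∑ j : Fin r, (((1 + k) ^ μ - 1) / k ^ μ) ^ (j : ℕ) * E j ^ μ := by
  have hK : 0 ≤ ((1 + k) ^ μ - 1) / k ^ μ :=
    div_nonneg (sub_nonneg.2 (one_le_rpow (by linarith) hμ.1.le)) (by positivity)
  induction r with
  | zero => simp [Real.zero_rpow hμ.1.ne']
  | succ r ih =>
    have ih' := ih (fun j => E j.succ) (fun j => hE _) fun l hl => by
      rw [← Fin.sum_Ioi_succ]
      exact hcond l.succ (by simpa using hl)
    rw [Fin.sum_univ_succ, Fin.sum_univ_succ]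
    have h0 : ∑ j : Fin r, E j.succ ≤ k * E 0 := by
      -- No condition is assumed at the last index; there the tail is empty.
      rcases Nat.eq_zero_or_pos r with rfl | hr
      · simpa using mul_nonneg hk.le (hE 0)
      · rw [← Fin.sum_Ioi_zero]
        exact hcond 0 (by simpa using hr)
    refine (add_rpow_le hμ hk (hE 0) (Finset.sum_nonneg fun j _ => hE _) h0).trans ?_
    simp only [Fin.val_zero, pow_zero, one_mul, Fin.val_succ, pow_succ']
    refine add_le_add_right ((mul_le_mul_of_nonneg_left ih' hK).trans_eq ?_) _
    rw [Finset.mul_sum]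
    exact Finset.sum_congr rfl fun j _ => by ring

open Matrix

section Superposition

/-! ### Entropy of superpositions of a single excitation and the vacuum -/

/-- V Vᴴ and the 2 × 2 Gram matrix Vᴴ V have the same characteristic polynomial up to powers of X;
`g 0 = 0` makes the extra zero eigenvalues harmless. -/
theorem sum_eigenvalues_eq_of_mul_conjTranspose {A : Type*} [Fintype A] [DecidableEq A]
    {M : Matrix A A ℂ} (hM : M.IsHermitian) (V : Matrix A (Fin 2) ℂ) (hV : M = V * Vᴴ) {l m : ℝ}
    (htr : (Vᴴ * V).trace = (l : ℂ) + m) (hdet : (Vᴴ * V).det = (l : ℂ) * m)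
    (g : ℝ → ℝ) (g0 : g 0 = 0) : ∑ i, g (hM.eigenvalues i) = g l + g m := by
  have hp : (Vᴴ * V).charpoly
      = (Polynomial.X - Polynomial.C (l : ℂ)) * (Polynomial.X - Polynomial.C (m : ℂ)) := by
    rw [charpoly_fin_two, htr, hdet, Polynomial.C_add, Polynomial.C_mul]
    ring
  have h := charpoly_mul_comm' V Vᴴ
  rw [hp, ← hV] at h
  have hX := Polynomial.X_ne_zero (R := ℂ)
  have n1 := Polynomial.X_sub_C_ne_zero (l : ℂ)
  have n2 := Polynomial.X_sub_C_ne_zero (m : ℂ)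
  have hr := congrArg Polynomial.roots h
  rw [Polynomial.roots_mul (mul_ne_zero (pow_ne_zero _ hX) M.charpoly_monic.ne_zero),
    Polynomial.roots_mul (mul_ne_zero (pow_ne_zero _ hX) (mul_ne_zero n1 n2)),
    Polynomial.roots_mul (mul_ne_zero n1 n2), Polynomial.roots_pow, Polynomial.roots_pow,
    Polynomial.roots_X, Polynomial.roots_X_sub_C, Polynomial.roots_X_sub_C,
    hM.roots_charpoly_eq_eigenvalues] at hr
  have := congrArg (fun s => (s.map fun z : ℂ => g z.re).sum) hr
  simpa [Multiset.map_nsmul, Multiset.sum_nsmul, g0] using this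

variable {A B : Type*} [DecidableEq A] [DecidableEq B]

/-- The vector `wA ⊗ |0⟩ + |0⟩ ⊗ wB` of a bipartite system with vacuum labels `oA`, `oB`. -/
def excitation (oA : A) (oB : B) (wA : A → ℂ) (wB : B → ℂ) : A × B → ℂ := fun u =>
  wA u.1 * (Pi.single oB 1 : B → ℂ) u.2 + (Pi.single oA 1 : A → ℂ) u.1 * wB u.2

theorem excitation_vacuum {oA : A} {oB : B} {wA : A → ℂ} {wB : B → ℂ} (hA : wA oA = 0)
    (hB : wB oB = 0) : excitation oA oB wA wB (oA, oB) = 0 := by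
  simp [excitation, hA, hB]

theorem sum_mul_single {X : Type*} [Fintype X] [DecidableEq X] (o : X) (f : X → ℂ) :
    ∑ x, f x * (Pi.single o 1 : X → ℂ) x = f o := by
  simp [Pi.single_apply]

variable [Fintype A] [Fintype B]

theorem sum_normSq_excitation {oA : A} {oB : B} {wA : A → ℂ} {wB : B → ℂ} (hA : wA oA = 0) :
    ∑ u, ‖excitation oA oB wA wB u‖ ^ 2 = ∑ u, ‖wA u‖ ^ 2 + ∑ v, ‖wB v‖ ^ 2 := by
  have key : ∀ u : A × B, ‖excitation oA oB wA wB u‖ ^ 2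
      = (if u.2 = oB then ‖wA u.1‖ ^ 2 else 0) + if u.1 = oA then ‖wB u.2‖ ^ 2 else 0 := by
    rintro ⟨u, v⟩
    by_cases h1 : u = oA <;> by_cases h2 : v = oB <;> simp [excitation, h1, h2, hA]
  simp_rw [key, Finset.sum_add_distrib, Fintype.sum_prod_type]
  congr 1
  · simp
  · rw [Finset.sum_comm]
    simp

theorem sum_normSq_smul_add_smul_single {X : Type*} [Fintype X] [DecidableEq X] {w : X → ℂ} {o : X}
    (hw : w o = 0) (x y : ℂ) :
    ∑ u, ‖(x • w + y • (Pi.single o 1 : X → ℂ)) u‖ ^ 2 = ‖x‖ ^ 2 * ∑ u, ‖w u‖ ^ 2 + ‖y‖ ^ 2 := by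
  have key : ∀ u, ‖(x • w + y • (Pi.single o 1 : X → ℂ)) u‖ ^ 2
      = ‖x‖ ^ 2 * ‖w u‖ ^ 2 + if u = o then ‖y‖ ^ 2 else 0 := by
    intro u
    by_cases h : u = o <;> simp [h, hw, mul_pow]
  simp_rw [key, Finset.sum_add_distrib, ← Finset.mul_sum]
  simp

theorem sum_mul_star_self {X : Type*} [Fintype X] (f : X → ℂ) :
    ∑ x, f x * star (f x) = ((∑ x, ‖f x‖ ^ 2 : ℝ) : ℂ) := by
  push_cast
  exact Finset.sum_congr rfl fun x _ => Complex.mul_conj' _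

theorem pureRenyiEntanglement_superposition {α : ℝ} (h0 : 0 < α) {oA : A} {oB : B} {wA : A → ℂ}
    {wB : B → ℂ} (hA : wA oA = 0) (hB : wB oB = 0) {x y : ℂ}
    (hxy : ‖x‖ ^ 2 * (∑ u, ‖wA u‖ ^ 2 + ∑ v, ‖wB v‖ ^ 2) + ‖y‖ ^ 2 = 1) :
    pureRenyiEntanglement α (x • excitation oA oB wA wB + y • (Pi.single (oA, oB) 1 : A × B → ℂ)) =
      binaryRenyi α (4 * ‖x‖ ^ 4 * (∑ u, ‖wA u‖ ^ 2) * ∑ v, ‖wB v‖ ^ 2) := by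
  set a := ∑ u, ‖wA u‖ ^ 2 with ha
  set b := ∑ v, ‖wB v‖ ^ 2 with hb
  have ha0 : 0 ≤ a := Finset.sum_nonneg fun _ _ => by positivity
  have hb0 : 0 ≤ b := Finset.sum_nonneg fun _ _ => by positivity
  set φ := x • excitation oA oB wA wB + y • (Pi.single (oA, oB) 1 : A × B → ℂ) with hφ
  -- The columns are the A-parts accompanying |0⟩ and wB / √b, which are orthonormal in B if b ≠ 0.
  -- The Gram matrix has trace 1, and the |y|² terms cancel in its determinant, leaving s / 4.
  let V : Matrix A (Fin 2) ℂ := Matrix.of fun u =>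
    ![x * wA u + y * (Pi.single oA 1 : A → ℂ) u, (√b : ℂ) * x * (Pi.single oA 1 : A → ℂ) u]
  have hφ' : ∀ u v, φ (u, v) = V u 0 * (Pi.single oB 1 : B → ℂ) v
      + x * (Pi.single oA 1 : A → ℂ) u * wB v := by
    intro u v
    by_cases h1 : u = oA <;> by_cases h2 : v = oB <;>
      simp [hφ, V, excitation, h1, h2, hA, hB]
  have hbb : (√b : ℂ) * √b = b := by rw [← Complex.ofReal_mul, mul_self_sqrt hb0]
  have hV : reducedLeft φ = V * Vᴴ := by
    ext u u'
    have hsum : ∑ v, φ (u, v) * star (φ (u', v)) = V u 0 * star (V u' 0)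
        + x * (Pi.single oA 1 : A → ℂ) u * star (x * (Pi.single oA 1 : A → ℂ) u') * b := by
      have hb' : ∑ v, wB v * star (wB v) = (b : ℂ) := sum_mul_star_self wB
      rw [← hb', Finset.mul_sum, ← sum_mul_single oB fun _ => V u 0 * star (V u' 0),
        ← Finset.sum_add_distrib]
      refine Finset.sum_congr rfl fun v _ => ?_
      rw [hφ', hφ']
      by_cases h2 : v = oB
      · subst h2
        simp [hB]
      · rw [Pi.single_eq_of_ne h2]
        simp only [mul_zero, zero_add, star_mul']
        ring
    rw [reducedLeft, of_apply, hsum, mul_apply, Fin.sum_univ_two]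
    simp only [conjTranspose_apply, V, of_apply, cons_val_zero, cons_val_one, star_mul',
      Complex.star_def, Complex.conj_ofReal, ← hbb]
    ring
  have hWA : ∑ u, wA u * star (wA u) = (a : ℂ) := sum_mul_star_self wA
  have g : ∀ i j, (Vᴴ * V) i j = ∑ u, star (V u i) * V u j := fun i j => by
    simp [mul_apply, conjTranspose_apply]
  have g00 : (Vᴴ * V) 0 0 = ((‖x‖ ^ 2 * a + ‖y‖ ^ 2 : ℝ) : ℂ) := by
    rw [g, ha, ← sum_normSq_smul_add_smul_single hA x y, ← sum_mul_star_self]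
    refine Finset.sum_congr rfl fun u _ => ?_
    simp [V, mul_comm]
  have g01 : (Vᴴ * V) 0 1 = star y * x * √b := by
    rw [g]
    simp only [V, of_apply, cons_val_zero, cons_val_one, ← mul_assoc]
    rw [sum_mul_single oA fun u => star (x * wA u + y * (Pi.single oA 1 : A → ℂ) u) * √b * x]
    simp [hA]
    ring
  have g10 : (Vᴴ * V) 1 0 = y * star x * √b := by
    rw [← (isHermitian_conjTranspose_mul_self V).apply, g01]
    simp
  have g11 : (Vᴴ * V) 1 1 = ((‖x‖ ^ 2 * b : ℝ) : ℂ) := by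
    rw [g]
    simp only [V, of_apply, cons_val_zero, cons_val_one, ← mul_assoc]
    rw [sum_mul_single oA fun u => star (√b * x * (Pi.single oA 1 : A → ℂ) u) * √b * x]
    push_cast
    rw [← Complex.mul_conj', ← hbb]
    simp
    ring
  set s := 4 * ‖x‖ ^ 4 * a * b with hs
  have hs1 : s ≤ 1 := by
    have h1 : ‖x‖ ^ 2 * (a + b) ≤ 1 := by nlinarith [sq_nonneg ‖y‖]
    have h2 : 0 ≤ ‖x‖ ^ 2 * (a + b) := by positivity
    have h3 : (‖x‖ ^ 2 * (a + b)) ^ 2 ≤ 1 := pow_le_one₀ h2 h1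
    nlinarith [sq_nonneg (‖x‖ ^ 2 * (a - b))]
  have hsq : √(1 - s) * √(1 - s) = 1 - s := mul_self_sqrt (by linarith)
  have htr : (Vᴴ * V).trace = (((1 + √(1 - s)) / 2 : ℝ) : ℂ) + ((1 - √(1 - s)) / 2 : ℝ) := by
    rw [trace_fin_two, g00, g11, ← Complex.ofReal_add, ← Complex.ofReal_add]
    congr 1
    linarith
  have hdet : (Vᴴ * V).det = (((1 + √(1 - s)) / 2 : ℝ) : ℂ) * ((1 - √(1 - s)) / 2 : ℝ) := by
    have e1 : star y * x * √b * (y * star x * √b) = ((‖y‖ ^ 2 * ‖x‖ ^ 2 * b : ℝ) : ℂ) := by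
      push_cast
      rw [← Complex.mul_conj', ← Complex.mul_conj', ← hbb]
      simp
      ring
    rw [det_fin_two, g00, g11, g01, g10, e1, ← Complex.ofReal_mul, ← Complex.ofReal_mul,
      ← Complex.ofReal_sub]
    congr 1
    have : (1 + √(1 - s)) / 2 * ((1 - √(1 - s)) / 2) = s / 4 := by linear_combination -hsq / 4
    rw [this, hs]
    ring
  have key := sum_eigenvalues_eq_of_mul_conjTranspose (reducedLeft_isHermitian φ) V hV htr hdet
  unfold pureRenyiEntanglement renyiEntropy binaryRenyi
  split_ifs with h
  · rw [key (fun z => z * logb 2 z) (by simp)]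
  · rw [key (fun z => z ^ α) (Real.zero_rpow h0.ne')]

end Superposition

section Decomposition

/-! ### Pure state decompositions of mixtures of a single excitation and the vacuum -/

/-- The operator `p |w⟩⟨w| + s (|w⟩⟨o| + |o⟩⟨w|) + e |o⟩⟨o|`. -/
def vacuumMixture {X : Type*} [DecidableEq X] (w : X → ℂ) (o : X) (p s e : ℝ) : Matrix X X ℂ :=
  (p : ℂ) • vecMulVec w (star w) +
    (s : ℂ) • (vecMulVec w (Pi.single o 1) + vecMulVec (Pi.single o 1) (star w)) +
    (e : ℂ) • vecMulVec (Pi.single o 1) (Pi.single o 1)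

/-- Equating this form with that of a decomposition at well-chosen vectors yields the support and
the moments of its members. -/
theorem form_vacuumMixture {X : Type*} [Fintype X] [DecidableEq X] (w : X → ℂ) (o : X) (p s e : ℝ)
    (v v' : X → ℂ) : star v ⬝ᵥ (vacuumMixture w o p s e *ᵥ v') =
      p * (star v ⬝ᵥ w) * (star w ⬝ᵥ v') + s * ((star v ⬝ᵥ w) * v' o + star (v o) * (star w ⬝ᵥ v'))
        + e * (star (v o) * v' o) := by
  simp only [vacuumMixture, add_mulVec, smul_mulVec, vecMulVec_mulVec, dotProduct_add,
    dotProduct_smul, op_smul_eq_mul, single_one_dotProduct, dotProduct_single_one, smul_eq_mul,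
    Pi.star_apply]
  ring

theorem form_decomposition {X : Type*} [Fintype X] {N : ℕ} (q : Fin N → ℝ) (φ : Fin N → X → ℂ)
    (v v' : X → ℂ) :
    star v ⬝ᵥ ((∑ i, (q i : ℂ) • vecMulVec (φ i) (star (φ i))) *ᵥ v') =
      ∑ i, (q i : ℂ) * ((star v ⬝ᵥ φ i) * (star (φ i) ⬝ᵥ v')) := by
  simp only [sum_mulVec, smul_mulVec, vecMulVec_mulVec, dotProduct_sum,
    dotProduct_smul, op_smul_eq_mul, smul_eq_mul]

theorem star_dotProduct_self {X : Type*} [Fintype X] (w : X → ℂ) :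
    star w ⬝ᵥ w = ((∑ u, ‖w u‖ ^ 2 : ℝ) : ℂ) := by
  rw [← sum_mul_star_self]
  exact Finset.sum_congr rfl fun x _ => mul_comm _ _

/-- Boundedness is needed because a real `sSup` of an unbounded set is 0. -/
theorem le_renyiAssistance {A B : Type*} [Fintype A] [DecidableEq A] [Fintype B] {α : ℝ}
    {ρ : Matrix (A × B) (A × B) ℂ}
    (hbdd : BddAbove {E : ℝ | ∃ (N : ℕ) (q : Fin N → ℝ) (φ : Fin N → A × B → ℂ),
      IsPureDecomposition ρ q φ ∧ E = ∑ i, q i * pureRenyiEntanglement α (φ i)})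
    {ι : Type*} [Fintype ι] (q : ι → ℝ) (φ : ι → A × B → ℂ) (hq : ∀ i, 0 ≤ q i)
    (hsum : ∑ i, q i = 1) (hφ : ∀ i, ∑ u, ‖φ i u‖ ^ 2 = 1)
    (hρ : ρ = ∑ i, (q i : ℂ) • vecMulVec (φ i) (star (φ i))) :
    ∑ i, q i * pureRenyiEntanglement α (φ i) ≤ renyiAssistance α ρ := by
  let f := (Fintype.equivFin ι).symm
  refine le_csSup hbdd ⟨Fintype.card ι, q ∘ f, φ ∘ f, ⟨fun i => hq _, ?_, fun i => hφ _, ?_⟩, ?_⟩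
  · rw [← hsum]
    exact f.sum_comp q
  · rw [hρ]
    exact (f.sum_comp fun i => (q i : ℂ) • vecMulVec (φ i) (star (φ i))).symm
  · exact (f.sum_comp fun i => q i * pureRenyiEntanglement α (φ i)).symm

variable {A B : Type*} [Fintype A] [DecidableEq A] [Fintype B] [DecidableEq B]

open scoped ComplexOrder in
-- The component z of φ_i orthogonal to w and o satisfies 0 = ⟨z|ρ|z⟩ = ∑ q_j |⟨z|φ_j⟩|², so ⟨z|φ_i⟩
-- = 0 and z = 0. The two moments come from testing ρ at (w, w) and (w, o).
theorem IsPureDecomposition.exists_amplitudes {w : A × B → ℂ} {o : A × B} (hw : w o = 0)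
    {p s e : ℝ} {N : ℕ} {q : Fin N → ℝ} {φ : Fin N → A × B → ℂ}
    (h : IsPureDecomposition (vacuumMixture w o p s e) q φ) :
    ∃ x y : Fin N → ℂ, (∀ i, ‖x i‖ ^ 2 * ∑ u, ‖w u‖ ^ 2 + ‖y i‖ ^ 2 = 1) ∧
      (∀ i, q i ≠ 0 → φ i = x i • w + y i • (Pi.single o 1 : A × B → ℂ)) ∧
      (∑ u, ‖w u‖ ^ 2 ≠ 0 → ∑ i, q i * ‖x i‖ ^ 2 = p ∧
        ∑ i, (q i : ℂ) * (x i * star (y i)) = s) := by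
  have hform := fun v v' => form_decomposition q φ v v'
  rw [← h.decomp] at hform
  simp only [form_vacuumMixture] at hform
  have hWw : star w ⬝ᵥ w = ((∑ u, ‖w u‖ ^ 2 : ℝ) : ℂ) := star_dotProduct_self w
  set W : ℝ := ∑ u, ‖w u‖ ^ 2 with hW
  -- If W = 0 then w = 0, and both sides vanish.
  have hx : ∀ i, (star w ⬝ᵥ φ i) / W * W = star w ⬝ᵥ φ i := by
    intro i
    by_cases h0 : W = 0
    · rw [h0, Complex.ofReal_zero, dotProduct_star_self_eq_zero] at hWw
      simp [h0, hWw]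
    · rw [div_mul_cancel₀ _ (by exact_mod_cast h0)]
  have hspan : ∀ i, q i ≠ 0 →
      φ i = ((star w ⬝ᵥ φ i) / W) • w + φ i o • (Pi.single o 1 : A × B → ℂ) := by
    intro i hi
    set z := φ i - (((star w ⬝ᵥ φ i) / W) • w + φ i o • (Pi.single o 1 : A × B → ℂ)) with hz
    have hzo : z o = 0 := by simp [hz, hw]
    have hwz : star w ⬝ᵥ z = 0 := by
      rw [hz, dotProduct_sub, dotProduct_add, dotProduct_smul, dotProduct_smul, hWw, smul_eq_mul,
        hx, dotProduct_single_one]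
      simp [hw]
    have hzw : star z ⬝ᵥ w = 0 := by rw [star_dotProduct, hwz, star_zero]
    have h1 := hform z z
    simp only [hzo, hzw, hwz] at h1
    have h2 : ∑ j, q j * ‖star z ⬝ᵥ φ j‖ ^ 2 = 0 := by
      have : ((∑ j, q j * ‖star z ⬝ᵥ φ j‖ ^ 2 : ℝ) : ℂ) = 0 := by
        push_cast
        simp only [mul_zero, star_zero, add_zero] at h1
        rw [h1]
        refine Finset.sum_congr rfl fun j _ => ?_
        rw [← Complex.mul_conj', star_dotProduct (φ j) z]
        rfl
      exact_mod_cast this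
    rw [Finset.sum_eq_zero_iff_of_nonneg fun j _ => mul_nonneg (h.nonneg j) (sq_nonneg _)] at h2
    have h3 : star z ⬝ᵥ φ i = 0 := by simpa [hi] using h2 i (Finset.mem_univ _)
    have h4 : star z ⬝ᵥ z = 0 := by
      nth_rewrite 2 [hz]
      rw [dotProduct_sub, dotProduct_add, dotProduct_smul, dotProduct_smul, h3, hzw,
        dotProduct_single_one]
      simp [hzo]
    rw [dotProduct_star_self_eq_zero] at h4
    exact sub_eq_zero.1 h4
  -- Members of weight zero need not lie in the span; the amplitudes (0, 1) keep the normalization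
  -- valid for them.
  refine ⟨fun i => if q i = 0 then 0 else (star w ⬝ᵥ φ i) / W,
    fun i => if q i = 0 then 1 else φ i o, fun i => ?_, fun i hi => ?_, fun hW0 => ⟨?_, ?_⟩⟩
  · by_cases hi : q i = 0
    · simp [hi]
    · simp only [hi, if_false]
      rw [← sum_normSq_smul_add_smul_single hw, ← hspan i hi, h.unit]
  · simpa [hi] using hspan i hi
  · have h1 := hform w w
    have hW0' : (W : ℂ) ≠ 0 := by exact_mod_cast hW0
    simp only [hw, hWw, mul_zero, star_zero, zero_mul, add_zero] at h1
    have h2 : ∀ i, (q i : ℂ) * ((star w ⬝ᵥ φ i) * (star (φ i) ⬝ᵥ w)) =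
        ((q i * ‖if q i = 0 then 0 else (star w ⬝ᵥ φ i) / W‖ ^ 2 : ℝ) : ℂ) * (W * W) := by
      intro i
      by_cases hi : q i = 0
      · simp [hi]
      · simp only [hi, if_false]
        push_cast
        rw [← Complex.mul_conj', star_dotProduct (φ i) w]
        simp
        field_simp
    simp only [h2, ← Finset.sum_mul, mul_assoc] at h1
    exact_mod_cast (mul_right_cancel₀ (mul_ne_zero hW0' hW0') h1).symm
  · have h1 := hform w (Pi.single o 1)
    have hW0' : (W : ℂ) ≠ 0 := by exact_mod_cast hW0
    simp only [hw, hWw, dotProduct_single_one, Pi.single_eq_same, Pi.star_apply, mul_zero,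
      star_zero, add_zero, zero_add, mul_one] at h1
    have h2 : ∀ i, (q i : ℂ) * ((star w ⬝ᵥ φ i) * star (φ i o)) =
        (q i : ℂ) * ((if q i = 0 then 0 else (star w ⬝ᵥ φ i) / W) *
          star (if q i = 0 then 1 else φ i o)) * W := by
      intro i
      by_cases hi : q i = 0
      · simp [hi]
      · simp only [hi, if_false]
        rw [← hx i]
        simp only [hx i]
        field_simp
    simp only [h2, ← Finset.sum_mul] at h1
    exact (mul_right_cancel₀ hW0' h1).symm

theorem concurrence_sq_mem {t a b : ℝ} (ha : 0 ≤ a) (hb : 0 ≤ b)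
    (h : t ^ 2 * (a + b) ≤ 1) : 4 * t ^ 4 * a * b ∈ Icc (0 : ℝ) 1 := by
  refine ⟨by positivity, ?_⟩
  have h3 : (t ^ 2 * (a + b)) ^ 2 ≤ 1 := pow_le_one₀ (by positivity) h
  nlinarith [sq_nonneg (t ^ 2 * (a - b))]

/-- Pythagoras: take z perpendicular to y in the real plane, with squared length T - |y|². -/
theorem exists_norm_add_sq_eq_norm_sub_sq (y : ℂ) {T : ℝ} (hT : ‖y‖ ^ 2 ≤ T) :
    ∃ z : ℂ, ‖y + z‖ ^ 2 = T ∧ ‖y - z‖ ^ 2 = T := by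
  obtain ⟨u, hu, hy⟩ : ∃ u : ℂ, ‖u‖ = 1 ∧ y = u * ‖y‖ := by
    by_cases h : y = 0
    · exact ⟨1, by simp, by simp [h]⟩
    · have : (‖y‖ : ℂ) ≠ 0 := by simpa using h
      exact ⟨y / ‖y‖, by simp [h], by rw [div_mul_cancel₀ _ this]⟩
  have hc : √(T - ‖y‖ ^ 2) ^ 2 = T - ‖y‖ ^ 2 := sq_sqrt (by linarith)
  generalize √(T - ‖y‖ ^ 2) = c at hc
  generalize ‖y‖ = m at *
  subst hy
  refine ⟨u * (c * Complex.I), ?_, ?_⟩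
  · rw [← mul_add, norm_mul, hu, one_mul, ← Complex.normSq_eq_norm_sq, Complex.normSq_add_mul_I]
    linarith
  · have : (m : ℂ) - c * Complex.I = m + ((-c : ℝ) : ℂ) * Complex.I := by push_cast; ring
    rw [← mul_sub, norm_mul, hu, one_mul, this, ← Complex.normSq_eq_norm_sq,
      Complex.normSq_add_mul_I]
    linarith

/-! ### Average entanglement of decompositions, and bounds for the assistance -/

section Excitation

variable {α : ℝ} {oA : A} {oB : B} {wA : A → ℂ} {wB : B → ℂ} {p s e : ℝ}

theorem IsPureDecomposition.exists_average_eq (h0 : 0 < α) (hA : wA oA = 0) (hB : wB oB = 0)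
    {N : ℕ} {q : Fin N → ℝ} {φ : Fin N → A × B → ℂ}
    (h : IsPureDecomposition (vacuumMixture (excitation oA oB wA wB) (oA, oB) p s e) q φ) :
    ∃ x y : Fin N → ℂ,
      (∀ i, ‖x i‖ ^ 2 * (∑ u, ‖wA u‖ ^ 2 + ∑ v, ‖wB v‖ ^ 2) + ‖y i‖ ^ 2 = 1) ∧
      (∑ i, q i * pureRenyiEntanglement α (φ i) =
        ∑ i, q i * binaryRenyi α (4 * ‖x i‖ ^ 4 * (∑ u, ‖wA u‖ ^ 2) * ∑ v, ‖wB v‖ ^ 2)) ∧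
      (∑ u, ‖wA u‖ ^ 2 + ∑ v, ‖wB v‖ ^ 2 ≠ 0 → ∑ i, q i * ‖x i‖ ^ 2 = p ∧
        ∑ i, (q i : ℂ) * (x i * star (y i)) = s) := by
  obtain ⟨x, y, h1, h2, h3⟩ := h.exists_amplitudes (excitation_vacuum hA hB)
  rw [sum_normSq_excitation hA] at h1 h3
  refine ⟨x, y, h1, Finset.sum_congr rfl fun i _ => ?_, h3⟩
  by_cases hi : q i = 0
  · simp [hi]
  · rw [h2 i hi, pureRenyiEntanglement_superposition h0 hA hB (h1 i)]

theorem bddAbove_average (h0 : 0 < α) (hA : wA oA = 0) (hB : wB oB = 0) :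
    BddAbove {E : ℝ | ∃ (N : ℕ) (q : Fin N → ℝ) (φ : Fin N → A × B → ℂ),
      IsPureDecomposition (vacuumMixture (excitation oA oB wA wB) (oA, oB) p s e) q φ ∧
        E = ∑ i, q i * pureRenyiEntanglement α (φ i)} := by
  obtain ⟨M, hM⟩ := exists_binaryRenyi_le h0
  refine ⟨M, ?_⟩
  rintro _ ⟨N, q, φ, h, rfl⟩
  obtain ⟨x, y, h1, h2, -⟩ := h.exists_average_eq h0 hA hB
  rw [h2]
  calc _ ≤ ∑ i, q i * M := Finset.sum_le_sum fun i _ => mul_le_mul_of_nonneg_left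
        (hM _ (concurrence_sq_mem (Finset.sum_nonneg fun _ _ => by positivity)
          (Finset.sum_nonneg fun _ _ => by positivity)
          (by linarith [h1 i, sq_nonneg ‖y i‖]))) (h.nonneg i)
    _ = M := by rw [← Finset.sum_mul, h.sum_eq_one, one_mul]

theorem renyiAssistance_vacuumMixture_nonneg (h0 : 1 / 2 < α) (h1 : α ^ 2 + α ≤ 3)
    (hA : wA oA = 0) (hB : wB oB = 0) :
    0 ≤ renyiAssistance α (vacuumMixture (excitation oA oB wA wB) (oA, oB) p s e) := by
  refine Real.sSup_nonneg ?_
  rintro _ ⟨N, q, φ, h, rfl⟩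
  obtain ⟨x, y, h3, h2, -⟩ := h.exists_average_eq (by linarith : 0 < α) hA hB
  rw [h2]
  exact Finset.sum_nonneg fun i _ => mul_nonneg (h.nonneg i) (binaryRenyi_nonneg h0 h1
    (concurrence_sq_mem (Finset.sum_nonneg fun _ _ => by positivity)
          (Finset.sum_nonneg fun _ _ => by positivity)
          (by linarith [h3 i, sq_nonneg ‖y i‖])))

/-- Subnormalized amplitudes suffice: each (x, y) is split into (x, y + z) and (x, y - z) of half
the weight, both normalized. The moment ∑ q x ȳ is kept since ±z cancel, the vacuum coefficient is
then 1 - pW, and the entropy does not depend on y. -/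
theorem average_le_renyiAssistance_vacuumMixture (h0 : 0 < α) (hA : wA oA = 0) (hB : wB oB = 0)
    {W : ℝ} (hW : W = ∑ u, ‖wA u‖ ^ 2 + ∑ v, ‖wB v‖ ^ 2)
    {N : ℕ} {q : Fin N → ℝ} (hq : ∀ i, 0 ≤ q i) (hsum : ∑ i, q i = 1) {x y : Fin N → ℂ}
    (hxy : ∀ i, ‖x i‖ ^ 2 * W + ‖y i‖ ^ 2 ≤ 1) (hp : ∑ i, q i * ‖x i‖ ^ 2 = p)
    (hs : ∑ i, (q i : ℂ) * (x i * star (y i)) = s) :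
    ∑ i, q i * binaryRenyi α (4 * ‖x i‖ ^ 4 * (∑ u, ‖wA u‖ ^ 2) * ∑ v, ‖wB v‖ ^ 2) ≤
      renyiAssistance α
        (vacuumMixture (excitation oA oB wA wB) (oA, oB) p s (1 - p * W)) := by
  have hz := fun i => exists_norm_add_sq_eq_norm_sub_sq (y i) (T := 1 - ‖x i‖ ^ 2 * W)
    (by linarith [hxy i])
  choose z hz1 hz2 using hz
  set w := excitation oA oB wA wB with hw
  have hwo : w (oA, oB) = 0 := excitation_vacuum hA hB
  have hWw : ∑ u, ‖w u‖ ^ 2 = W := by rw [hw, sum_normSq_excitation hA, hW]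
  let Y : Fin N × Bool → ℂ := fun i => if i.2 then y i.1 + z i.1 else y i.1 - z i.1
  have hY : ∀ i, ‖x i.1‖ ^ 2 * W + ‖Y i‖ ^ 2 = 1 := by
    rintro ⟨i, _ | _⟩
    · simp [Y, hz2]
    · simp [Y, hz1]
  have key := le_renyiAssistance (bddAbove_average h0 hA hB (p := p) (s := s) (e := 1 - p * W))
    (fun i : Fin N × Bool => q i.1 / 2)
    (fun i => x i.1 • w + Y i • (Pi.single (oA, oB) 1 : A × B → ℂ)) (fun i => by
      have := hq i.1
      positivity) ?_ (fun i => ?_) ?_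
  · refine le_trans (le_of_eq ?_) key
    rw [Fintype.sum_prod_type]
    refine Finset.sum_congr rfl fun i _ => ?_
    rw [Fintype.sum_bool]
    rw [hW] at hY
    rw [pureRenyiEntanglement_superposition h0 hA hB (hY (i, true)),
      pureRenyiEntanglement_superposition h0 hA hB (hY (i, false))]
    ring
  · rw [Fintype.sum_prod_type, ← hsum]
    exact Finset.sum_congr rfl fun i _ => by rw [Fintype.sum_bool]; ring
  · rw [sum_normSq_smul_add_smul_single hwo, hWw, hY]
  · have hs' : ∑ i, (q i : ℂ) * (y i * star (x i)) = s := by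
      rw [← Complex.conj_ofReal s, ← hs, map_sum]
      exact Finset.sum_congr rfl fun i _ => by simp [mul_comm]
    have hp' : ∑ i, (q i : ℂ) * ((‖x i‖ : ℂ) ^ 2) = p := by
      rw [← hp]
      push_cast
      rfl
    have he : ((1 - p * W : ℝ) : ℂ) = ∑ i, (q i : ℂ) * (1 - (‖x i‖ : ℂ) ^ 2 * W) := by
      simp only [mul_sub, mul_one, ← mul_assoc, Finset.sum_sub_distrib, ← Finset.sum_mul, hp']
      rw [← Complex.ofReal_sum, hsum]
      push_cast
      rfl
    rw [vacuumMixture, he]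
    nth_rewrite 1 [← hp']
    ext u v
    have hpair : ∀ i, ∑ b : Bool, ((q i / 2 : ℝ) : ℂ) *
          ((x i * w u + Y (i, b) * (Pi.single (oA, oB) 1 : A × B → ℂ) u) *
            star (x i * w v + Y (i, b) * (Pi.single (oA, oB) 1 : A × B → ℂ) v)) =
        q i * (‖x i‖ : ℂ) ^ 2 * (w u * star (w v)) +
          q i * (x i * star (y i)) * (w u * (Pi.single (oA, oB) 1 : A × B → ℂ) v) +
          q i * (y i * star (x i)) * ((Pi.single (oA, oB) 1 : A × B → ℂ) u * star (w v)) +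
          q i * (1 - (‖x i‖ : ℂ) ^ 2 * W) * ((Pi.single (oA, oB) 1 : A × B → ℂ) u *
            (Pi.single (oA, oB) 1 : A × B → ℂ) v) := by
      intro i
      have c1 : (y i + z i) * star (y i + z i) = 1 - (‖x i‖ : ℂ) ^ 2 * W := by
        rw [Complex.star_def, Complex.mul_conj', ← Complex.ofReal_pow, hz1]
        push_cast
        rfl
      have c2 : (y i - z i) * star (y i - z i) = 1 - (‖x i‖ : ℂ) ^ 2 * W := by
        rw [Complex.star_def, Complex.mul_conj', ← Complex.ofReal_pow, hz2]
        push_cast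
        rfl
      have c3 : star ((Pi.single (oA, oB) 1 : A × B → ℂ) v) =
          (Pi.single (oA, oB) 1 : A × B → ℂ) v := by
        by_cases hv : v = (oA, oB) <;> simp [hv]
      rw [Fintype.sum_bool]
      simp only [Y, if_true, Bool.false_eq_true, if_false, star_add, star_mul', c3, star_sub]
        at c1 c2 ⊢
      rw [← Complex.mul_conj', ← Complex.star_def] at *
      push_cast
      generalize (Pi.single (oA, oB) 1 : A × B → ℂ) u = ou
      generalize (Pi.single (oA, oB) 1 : A × B → ℂ) v = ov
      linear_combination (q i / 2 * ou * ov) * c1 + (q i / 2 * ou * ov) * c2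
    rw [Fintype.sum_prod_type]
    simp only [Matrix.add_apply, Matrix.smul_apply, vecMulVec_apply, Pi.star_apply, smul_eq_mul,
      Matrix.sum_apply, Pi.add_apply, Pi.smul_apply, hpair,
      Finset.sum_add_distrib, ← Finset.sum_mul, hs, hs']
    ring

end Excitation

end Decomposition

section ReducedState

/-! ### Reduced states of generalized W-class–vacuum states -/

variable {n d : ℕ}

theorem glue_eq_iff {P Q : Finset (Fin n)} (hPQ : Disjoint P Q) {x : ↥P → Fin d} {y : ↥Q → Fin d}
    {z : ↥((P ∪ Q)ᶜ) → Fin d} {v : Fin n → Fin d} :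
    glue P Q x y z = v ↔ x = (fun s : ↥P => v s) ∧ y = (fun s : ↥Q => v s) ∧
      z = fun s : ↥((P ∪ Q)ᶜ) => v s := by
  constructor
  · rintro rfl
    refine ⟨funext fun s => ?_, funext fun s => ?_, funext fun s => ?_⟩
    · simp [glue, s.2]
    · simp [glue, s.2, Finset.disjoint_right.1 hPQ s.2]
    · have := s.2
      simp only [Finset.compl_union, Finset.mem_inter, Finset.mem_compl] at this
      simp [glue, this.1, this.2]
  · rintro ⟨rfl, rfl, rfl⟩
    funext s
    simp only [glue]
    split_ifs <;> rfl

variable [NeZero d]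

theorem restrict_single_of_mem {S : Finset (Fin n)} {s : Fin n} (hs : s ∈ S) (i : Fin d) :
    (fun t : ↥S => (Pi.single s i : Fin n → Fin d) t) = Pi.single ⟨s, hs⟩ i := by
  funext t
  simp [Pi.single_apply, Subtype.ext_iff]

theorem restrict_single_of_notMem {S : Finset (Fin n)} {s : Fin n} (hs : s ∉ S) (i : Fin d) :
    (fun t : ↥S => (Pi.single s i : Fin n → Fin d) t) = 0 := by
  funext t
  have : (t : Fin n) ≠ s := fun h => hs (h ▸ t.2)
  simp [this]

/-- The part `∑ s ∈ S, ∑ i ≠ 0, a s i |0 … 0 i 0 … 0⟩` of the `W`-class vector living on the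
block `S`. -/
def blockVector (a : Fin n → Fin d → ℂ) (S : Finset (Fin n)) : (↥S → Fin d) → ℂ := fun x =>
  ∑ s : ↥S, ∑ i ∈ Finset.univ.erase (0 : Fin d),
    a s i * if x = (Pi.single s i : ↥S → Fin d) then 1 else 0

/-- The squared norm of `blockVector a S`. -/
def blockWeight (a : Fin n → Fin d → ℂ) (S : Finset (Fin n)) : ℝ :=
  ∑ s ∈ S, ∑ i ∈ Finset.univ.erase (0 : Fin d), ‖a s i‖ ^ 2

theorem blockWeight_nonneg (a : Fin n → Fin d → ℂ) (S : Finset (Fin n)) : 0 ≤ blockWeight a S :=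
  Finset.sum_nonneg fun _ _ => Finset.sum_nonneg fun _ _ => by positivity

theorem blockWeight_union (a : Fin n → Fin d → ℂ) {S T : Finset (Fin n)} (h : Disjoint S T) :
    blockWeight a (S ∪ T) = blockWeight a S + blockWeight a T := Finset.sum_union h

theorem blockVector_zero (a : Fin n → Fin d → ℂ) (S : Finset (Fin n)) : blockVector a S 0 = 0 := by
  refine Finset.sum_eq_zero fun s _ => Finset.sum_eq_zero fun i hi => ?_
  have : (0 : ↥S → Fin d) ≠ Pi.single s i := fun h => (Finset.mem_erase.1 hi).1 (by
    simpa using (congrFun h s).symm)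
  simp [this]

theorem blockVector_single (a : Fin n → Fin d → ℂ) (S : Finset (Fin n)) (s : ↥S) {i : Fin d}
    (hi : i ≠ 0) : blockVector a S (Pi.single s i) = a s i := by
  have key : ∀ s' : ↥S, ∀ i' : Fin d, (Pi.single s i : ↥S → Fin d) = Pi.single s' i' ↔
      s' = s ∧ i' = i := by
    intro s' i'
    constructor
    · intro h
      have h1 := congrFun h s
      by_cases hs : s = s'
      · subst hs
        simpa [eq_comm] using h1
      · simp [hs, hi] at h1
    · rintro ⟨rfl, rfl⟩
      rfl
  simp only [blockVector, key]
  rw [Finset.sum_eq_single s (fun s' _ hs' => Finset.sum_eq_zero fun i' _ => by simp [hs'])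
    (by simp), Finset.sum_eq_single i (fun i' _ hi' => by simp [hi']) (by simp [hi])]
  simp

theorem sum_normSq_blockVector (a : Fin n → Fin d → ℂ) (S : Finset (Fin n)) :
    ∑ x, ‖blockVector a S x‖ ^ 2 = blockWeight a S := by
  have : ∑ x, blockVector a S x * star (blockVector a S x) = (blockWeight a S : ℂ) := by
    have h : ∀ x, blockVector a S x * star (blockVector a S x) =
        ∑ s : ↥S, ∑ i ∈ Finset.univ.erase (0 : Fin d),
          if x = (Pi.single s i : ↥S → Fin d) then a s i * star (blockVector a S x) else 0 := by
      intro x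
      nth_rewrite 1 [blockVector]
      rw [Finset.sum_mul]
      refine Finset.sum_congr rfl fun s _ => ?_
      rw [Finset.sum_mul]
      refine Finset.sum_congr rfl fun i _ => ?_
      split_ifs <;> simp
    simp_rw [h]
    rw [Finset.sum_comm, blockWeight,
      ← Finset.sum_coe_sort S fun s => ∑ i ∈ Finset.univ.erase (0 : Fin d), ‖a s i‖ ^ 2]
    push_cast
    refine Finset.sum_congr rfl fun s _ => ?_
    rw [Finset.sum_comm]
    refine Finset.sum_congr rfl fun i hi => ?_
    simp only [Finset.sum_ite_eq', Finset.mem_univ, if_true]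
    rw [blockVector_single a S s (Finset.mem_erase.1 hi).1]
    exact Complex.mul_conj' _
  rw [sum_mul_star_self] at this
  exact_mod_cast this

theorem wState_glue (a : Fin n → Fin d → ℂ) {P Q : Finset (Fin n)} (hPQ : Disjoint P Q)
    (x : ↥P → Fin d) (y : ↥Q → Fin d) (z : ↥((P ∪ Q)ᶜ) → Fin d) :
    wState a (glue P Q x y z) =
      excitation 0 0 (blockVector a P) (blockVector a Q) (x, y) *
          (Pi.single 0 1 : (↥((P ∪ Q)ᶜ) → Fin d) → ℂ) z +
        (Pi.single (0, 0) 1 : (↥P → Fin d) × (↥Q → Fin d) → ℂ) (x, y) *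
          blockVector a (P ∪ Q)ᶜ z := by
  have h0 : wState a (glue P Q x y z) = ∑ s, ∑ i ∈ Finset.univ.erase (0 : Fin d),
      a s i * if x = (fun t : ↥P => (Pi.single s i : Fin n → Fin d) t) ∧
        y = (fun t : ↥Q => (Pi.single s i : Fin n → Fin d) t) ∧
        z = (fun t : ↥((P ∪ Q)ᶜ) => (Pi.single s i : Fin n → Fin d) t) then 1 else 0 := by
    simp only [wState, Finset.sum_apply, Pi.smul_apply, smul_eq_mul,
      Pi.single_apply _ _ (glue P Q x y z)]
    exact Finset.sum_congr rfl fun s _ => Finset.sum_congr rfl fun i _ => by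
      rw [if_congr (glue_eq_iff hPQ) rfl rfl]
  have hsplit : ∀ f : Fin n → ℂ, ∑ s, f s = ∑ s : ↥P, f s + ∑ s : ↥Q, f s +
      ∑ s : ↥((P ∪ Q)ᶜ), f s := fun f => by
    rw [Finset.sum_coe_sort P, Finset.sum_coe_sort Q, Finset.sum_coe_sort (P ∪ Q)ᶜ,
      ← Finset.sum_union hPQ, Finset.sum_add_sum_compl]
  rw [h0, hsplit, excitation, add_mul]
  have hs : ∀ {X : Type} [DecidableEq X] (o u : X), (Pi.single o 1 : X → ℂ) u =
      if u = o then 1 else 0 := fun o u => Pi.single_apply _ _ _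
  congr 1
  · congr 1
    · simp only [blockVector, Finset.sum_mul]
      refine Finset.sum_congr rfl fun s _ => Finset.sum_congr rfl fun i _ => ?_
      rw [restrict_single_of_mem s.2, restrict_single_of_notMem (Finset.disjoint_left.1 hPQ s.2),
        restrict_single_of_notMem (S := (P ∪ Q)ᶜ) (by simp [s.2]), hs, hs]
      by_cases h1 : x = Pi.single s i <;> by_cases h2 : y = 0 <;> by_cases h3 : z = 0 <;>
        simp [h1, h2, h3]
    · simp only [blockVector, Finset.sum_mul, Finset.mul_sum]
      refine Finset.sum_congr rfl fun s _ => Finset.sum_congr rfl fun i _ => ?_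
      rw [restrict_single_of_mem s.2, restrict_single_of_notMem (Finset.disjoint_right.1 hPQ s.2),
        restrict_single_of_notMem (S := (P ∪ Q)ᶜ) (by simp [s.2]), hs, hs]
      by_cases h1 : x = 0 <;> by_cases h2 : y = Pi.single s i <;> by_cases h3 : z = 0 <;>
        simp [h1, h2, h3]
  · simp only [blockVector, Finset.mul_sum]
    refine Finset.sum_congr rfl fun s _ => Finset.sum_congr rfl fun i _ => ?_
    have hm := s.2
    simp only [Finset.compl_union, Finset.mem_inter, Finset.mem_compl] at hm
    rw [restrict_single_of_mem s.2, restrict_single_of_notMem hm.1,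
        restrict_single_of_notMem hm.2, hs]
    by_cases h1 : x = 0 <;> by_cases h2 : y = 0 <;> by_cases h3 : z = Pi.single s i <;>
      simp [h1, h2, h3]

/-- An excitation outside `P ∪ Q` is orthogonal to the vacuum there, so it adds only an incoherent
vacuum term, of weight p times the outside block weight. -/
theorem reducedState_gwvState {p : ℝ} (hp : p ∈ Icc (0 : ℝ) 1) (a : Fin n → Fin d → ℂ)
    (ha : blockWeight a Finset.univ = 1) {P Q : Finset (Fin n)} (hPQ : Disjoint P Q) :
    reducedState (gwvState p a) P Q =
      vacuumMixture (excitation 0 0 (blockVector a P) (blockVector a Q)) (0, 0) p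
        (√p * √(1 - p)) (1 - p * (blockWeight a P + blockWeight a Q)) := by
  set w := excitation 0 0 (blockVector a P) (blockVector a Q) with hw
  have hψ : ∀ (u : (↥P → Fin d) × (↥Q → Fin d)) z, gwvState p a (glue P Q u.1 u.2 z) =
      (√p * w u + √(1 - p) * (Pi.single (0, 0) 1 : (↥P → Fin d) × (↥Q → Fin d) → ℂ) u) *
          (Pi.single 0 1 : (↥((P ∪ Q)ᶜ) → Fin d) → ℂ) z +
        √p * (Pi.single (0, 0) 1 : (↥P → Fin d) × (↥Q → Fin d) → ℂ) u *
          blockVector a (P ∪ Q)ᶜ z := by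
    rintro ⟨x, y⟩ z
    have h0 : (Pi.single (0 : Fin n → Fin d) 1 : (Fin n → Fin d) → ℂ) (glue P Q x y z) =
        (Pi.single (0, 0) 1 : (↥P → Fin d) × (↥Q → Fin d) → ℂ) (x, y) *
          (Pi.single 0 1 : (↥((P ∪ Q)ᶜ) → Fin d) → ℂ) z := by
      rw [Pi.single_apply, if_congr (glue_eq_iff hPQ) rfl rfl, Pi.single_apply, Pi.single_apply]
      change (if x = 0 ∧ y = 0 ∧ z = 0 then (1 : ℂ) else 0) = _
      by_cases h1 : x = 0 <;> by_cases h2 : y = 0 <;> by_cases h3 : z = 0 <;>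
        simp [h1, h2, h3]
    simp only [gwvState, Pi.add_apply, Pi.smul_apply, smul_eq_mul, wState_glue a hPQ, h0, ← hw]
    ring
  have hb : ∑ z, blockVector a (P ∪ Q)ᶜ z * star (blockVector a (P ∪ Q)ᶜ z) =
      (blockWeight a (P ∪ Q)ᶜ : ℂ) := by
    rw [sum_mul_star_self, sum_normSq_blockVector]
  have hc : 1 - p * (blockWeight a P + blockWeight a Q) = (1 - p) + p * blockWeight a (P ∪ Q)ᶜ := by
    rw [← blockWeight_union a hPQ]
    have := blockWeight_union a (disjoint_compl_right (a := P ∪ Q))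
    rw [Finset.union_compl, ha] at this
    linear_combination p * this
  have hp1 : (√p : ℂ) * √p = p := by rw [← Complex.ofReal_mul, mul_self_sqrt hp.1]
  have hp2 : (√(1 - p) : ℂ) * √(1 - p) = 1 - p := by
    rw [← Complex.ofReal_mul, mul_self_sqrt (by linarith [hp.2])]
    push_cast
    rfl
  ext u v
  have hsv : star ((Pi.single (0, 0) 1 : (↥P → Fin d) × (↥Q → Fin d) → ℂ) v) =
      (Pi.single (0, 0) 1 : (↥P → Fin d) × (↥Q → Fin d) → ℂ) v := by
    by_cases hv : v = (0, 0) <;> simp [hv]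
  simp only [reducedState, of_apply, hψ, vacuumMixture, Matrix.add_apply, Matrix.smul_apply,
    vecMulVec_apply, Pi.star_apply, smul_eq_mul, hc]
  push_cast
  rw [← hb, ← hp2]
  generalize hou : (Pi.single (0, 0) 1 : (↥P → Fin d) × (↥Q → Fin d) → ℂ) u = ou
  generalize (Pi.single (0, 0) 1 : (↥P → Fin d) × (↥Q → Fin d) → ℂ) v = ov at hsv
  have hsum : ∀ F G : ℂ, ∑ z, (F * (Pi.single 0 1 : (↥((P ∪ Q)ᶜ) → Fin d) → ℂ) z +
      √p * ou * blockVector a (P ∪ Q)ᶜ z) *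
      star (G * (Pi.single 0 1 : (↥((P ∪ Q)ᶜ) → Fin d) → ℂ) z +
        √p * ov * blockVector a (P ∪ Q)ᶜ z) =
      F * star G + p * ou * ov *
        ∑ z, blockVector a (P ∪ Q)ᶜ z * star (blockVector a (P ∪ Q)ᶜ z) := by
    intro F G
    rw [Finset.mul_sum, ← sum_mul_single (0 : ↥((P ∪ Q)ᶜ) → Fin d) fun _ => F * star G,
      ← Finset.sum_add_distrib]
    refine Finset.sum_congr rfl fun z _ => ?_
    simp only [star_add, star_mul', Complex.star_def, Complex.conj_ofReal] at hsv ⊢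
    by_cases hz : z = 0
    · subst hz
      simp [blockVector_zero]
    · rw [Pi.single_eq_of_ne hz, hsv, ← hp1]
      simp only [map_zero]
      ring
  rw [hsum]
  simp only [star_add, star_mul', hsv, Complex.star_def, Complex.conj_ofReal]
  rw [← hp1]
  ring

/-! ### Polygamy -/

variable {α p : ℝ} {a : Fin n → Fin d → ℂ}

theorem renyiAssistance_gwvState_nonneg (h0 : 1 / 2 < α) (h1 : α ^ 2 + α ≤ 3)
    (hp : p ∈ Icc (0 : ℝ) 1) (ha : blockWeight a Finset.univ = 1) {P Q : Finset (Fin n)}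
    (hPQ : Disjoint P Q) : 0 ≤ renyiAssistance α (reducedState (gwvState p a) P Q) := by
  rw [reducedState_gwvState hp a ha hPQ]
  exact renyiAssistance_vacuumMixture_nonneg h0 h1 (blockVector_zero a P) (blockVector_zero a Q)

theorem renyiAssistance_gwvState_biUnion_le (h0 : 1 / 2 < α) (h1 : α ^ 2 + α ≤ 3)
    (hp : p ∈ Icc (0 : ℝ) 1) (ha : blockWeight a Finset.univ = 1) {ι : Type*} [Fintype ι]
    {P : Finset (Fin n)} {Q : ι → Finset (Fin n)} (hPQ : ∀ j, Disjoint P (Q j))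
    (hQQ : ∀ i j, i ≠ j → Disjoint (Q i) (Q j)) :
    renyiAssistance α (reducedState (gwvState p a) P (Finset.univ.biUnion Q)) ≤
      ∑ j, renyiAssistance α (reducedState (gwvState p a) P (Q j)) := by
  have hα : 0 < α := by linarith
  have hsum0 : 0 ≤ ∑ j, renyiAssistance α (reducedState (gwvState p a) P (Q j)) :=
    Finset.sum_nonneg fun j _ => renyiAssistance_gwvState_nonneg h0 h1 hp ha (hPQ j)
  have hU : blockWeight a (Finset.univ.biUnion Q) = ∑ j, blockWeight a (Q j) :=
    Finset.sum_biUnion fun i _ j _ hij => hQQ i j hij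
  rw [reducedState_gwvState hp a ha
    ((Finset.disjoint_biUnion_right _ _ _).2 fun j _ => hPQ j)]
  refine Real.sSup_le ?_ hsum0
  rintro _ ⟨N, q, φ, h, rfl⟩
  obtain ⟨x, y, hxy, havg, hpar⟩ :=
    h.exists_average_eq hα (blockVector_zero a P) (blockVector_zero a _)
  simp only [sum_normSq_blockVector] at hxy havg hpar
  rw [havg]
  -- With W = 0 the moments are unavailable, but every s vanishes.
  by_cases hW : blockWeight a P + blockWeight a (Finset.univ.biUnion Q) = 0
  · have hP0 : blockWeight a P = 0 := by
      linarith [blockWeight_nonneg a P, blockWeight_nonneg a (Finset.univ.biUnion Q)]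
    simpa [hP0, binaryRenyi_zero hα] using hsum0
  obtain ⟨hp', hs'⟩ := hpar hW
  have hle : ∀ j, blockWeight a (Q j) ≤ blockWeight a (Finset.univ.biUnion Q) := fun j => by
    rw [hU]
    exact Finset.single_le_sum (f := fun j => blockWeight a (Q j))
      (fun i _ => blockWeight_nonneg a (Q i)) (Finset.mem_univ j)
  calc _ ≤ ∑ i, q i * ∑ j, binaryRenyi α (4 * ‖x i‖ ^ 4 * blockWeight a P * blockWeight a (Q j)) := by
        refine Finset.sum_le_sum fun i _ => mul_le_mul_of_nonneg_left ?_ (h.nonneg i)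
        rw [hU, Finset.mul_sum]
        refine binaryRenyi_sum_le h0 h1 _ _ (fun j _ => ?_) ?_
        · have := blockWeight_nonneg a P
          have := blockWeight_nonneg a (Q j)
          positivity
        · rw [← Finset.mul_sum, ← hU]
          exact (concurrence_sq_mem (blockWeight_nonneg a P) (blockWeight_nonneg a _)
            (by linarith [hxy i, sq_nonneg ‖y i‖])).2
    _ = ∑ j, ∑ i, q i * binaryRenyi α (4 * ‖x i‖ ^ 4 * blockWeight a P * blockWeight a (Q j)) := by
        simp only [Finset.mul_sum]
        exact Finset.sum_comm
    _ ≤ _ := by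
        refine Finset.sum_le_sum fun j _ => ?_
        rw [reducedState_gwvState hp a ha (hPQ j)]
        have key := average_le_renyiAssistance_vacuumMixture hα (blockVector_zero a P)
          (blockVector_zero a (Q j)) (W := blockWeight a P + blockWeight a (Q j))
          (by rw [sum_normSq_blockVector, sum_normSq_blockVector]) h.nonneg h.sum_eq_one
          (fun i => ?_) hp' hs'
        · simpa only [sum_normSq_blockVector] using key
        -- Shrinking the block lowers W, so the inherited amplitudes are subnormalized.
        · have := mul_le_mul_of_nonneg_left (add_le_add_right (hle j) (blockWeight a P))
            (sq_nonneg ‖x i‖)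
          linarith [hxy i]

end ReducedState

end GWV

end

theorem theorem12 {n d : ℕ} [NeZero d]
    (p : ℝ) (hp : p ∈ Set.Icc (0 : ℝ) 1)
    (a : Fin n → Fin d → ℂ)
    (ha : ∑ s : Fin n, ∑ i ∈ Finset.univ.erase (0 : Fin d), ‖a s i‖ ^ 2 = 1)
    {r : ℕ} (hr : 1 ≤ r)
    (P : Finset (Fin n)) (Q : Fin r → Finset (Fin n))
    (hP : P.Nonempty) (hQ : ∀ j, (Q j).Nonempty)
    (hPQ : ∀ j, Disjoint P (Q j))
    (hQQ : ∀ i j, i ≠ j → Disjoint (Q i) (Q j))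
    (α μ k : ℝ)
    (hα : α ∈ Set.Icc ((Real.sqrt 7 - 1) / 2) ((Real.sqrt 13 - 1) / 2))
    (hμ : μ ∈ Set.Ioc (0 : ℝ) 1) (hk : k ∈ Set.Ioc (0 : ℝ) 1)
    (hcond : ∀ l : Fin r, (l : ℕ) + 1 < r →
      ∑ j ∈ Finset.Ioi l, GWV.renyiAssistance α (GWV.reducedState (GWV.gwvState p a) P (Q j)) ≤
        k * GWV.renyiAssistance α (GWV.reducedState (GWV.gwvState p a) P (Q l))) :
    GWV.renyiAssistance α
        (GWV.reducedState (GWV.gwvState p a) P (Finset.univ.biUnion Q)) ^ μ ≤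
      ∑ j : Fin r, (((1 + k) ^ μ - 1) / k ^ μ) ^ (j : ℕ) *
        GWV.renyiAssistance α (GWV.reducedState (GWV.gwvState p a) P (Q j)) ^ μ := by
  have h7 : 2 < √7 := Real.lt_sqrt_of_sq_lt (by norm_num)
  have h13 : √13 ^ 2 = 13 := Real.sq_sqrt (by norm_num)
  have h0 : 1 / 2 < α := by linarith [hα.1]
  -- The upper endpoint is the positive root of α² + α = 3.
  have h1 : α ^ 2 + α ≤ 3 := by nlinarith [hα.2, Real.sqrt_nonneg 13]
  refine le_trans ?_ (GWV.sum_rpow_le hμ hk.1 _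
    (fun j => GWV.renyiAssistance_gwvState_nonneg h0 h1 hp ha (hPQ j)) hcond)
  exact Real.rpow_le_rpow (GWV.renyiAssistance_gwvState_nonneg h0 h1 hp ha
      ((Finset.disjoint_biUnion_right _ _ _).2 fun j _ => hPQ j))
    (GWV.renyiAssistance_gwvState_biUnion_le h0 h1 hp ha hPQ hQQ) hμ.1.le
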